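/- **Setting.** Let $X$ be a finite or countably infinite set, let $C$ be a class of functions $c:X\to\{0,1\}$ of finite VC dimension $d$, and let $n\ge 1$. For a probability distribution $D$ on $X$, functions $f,h:X\to\{0,1\}$ and $S\subseteq X$, put $\mathrm{rej}_D(S)=\Pr_{x\sim D}[x\notin S]$ and $\mathrm{err}_D(h|_S)=\Pr_{x\sim D}[h(x)\ne f(x)\wedge x\in S]$. For $z\in X^n$ and $g:X\to\{0,1\}$ put $\mathrm{err}_z(h|_S,g)=\frac1n|\{i: g(z_i)\neq h(z_i)\wedge z_i\in S\}|$, and $\mathrm{err}_z(h,g)=\mathrm{err}_z(h|_X,g)$. Let $\mathrm{ERM}$ be any deterministic oracle that, given a finite list of labelled examples from $X\times\{0,1\}$, returns a member of $C$ making the fewest mistakes on it. **Rejectron**$(x,y,\tilde x,\varepsilon)$, for $x,\tilde x\in X^n$, $y\in\{0,1\}^n$, with weight $\Lambda=n+1$: set $h=\mathrm{ERM}(x,y)$. For $t=1,2,\dots$: let $S_t=\{u\in X: h(u)=c_1(u)=\dots=c_{t-1}(u)\}$; choose $c_t\in C$ maximizing $s_t(c)=\mathrm{err}_{\tilde x}(h|_{S_t},c)-\Lambda\,\mathrm{err}_x(h,c)$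 over $c\in C$ (by any fixed deterministic rule); if $s_t(c_t)\le\varepsilon$, stop and return $h|_{S_t}$, i.e. the pair $(h,S_t)$. **Theorem.** Let $f\in C$, let $P,Q$ be probability distributions on $X$, and let $\delta>0$. Write $f(x)=(f(x_1),\dots,f(x_n))$; in each event below, "Rejectron halts" is part of the event and $h|_S$ denotes its output. 1. Let $\varepsilon^*=\sqrt{\dfrac{8d\ln(2n)}{n}}+\dfrac{8\ln(16/\delta)}{n}$ and $h|_S=\mathrm{Rejectron}(x,f(x),\tilde x,\varepsilon^*)$. Then $$\Pr_{x\sim P^n,\ \tilde x\sim Q^n}\big[\mathrm{err}_Q(h|_S)\le 2\varepsilon^*\ \wedge\ \mathrm{rej}_P(S)\le\varepsilon^*\big]\ \ge\ 1-\delta .$$ 2. (General trade-off.) With $h|_S=\mathrm{Rejectron}(x,f(x),\tilde x,\varepsilon)$: (a) for every $\varepsilon\ge\sqrt{\dfrac{8d\ln(2n)}{n}}+\dfrac{8\ln(8/\delta)}{n}$ and every $x\in X^n$, $$\Pr_{\tilde x\sim Q^n}\big[\mathrm{err}_Q(h|_S)\le 2\varepsilon\big]\ge 1-\delta ;$$ (b)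 for every $\varepsilon>0$, $$\Pr_{x\sim P^n}\Big[\forall\tilde x\in X^n:\ \mathrm{rej}_P(S)\le\frac2n\Big(\frac{2d}{\varepsilon}\log_2(2n)+\log_2\frac2\delta\Big)\Big]\ge 1-\delta .$$ -/

import Mathlib

open MeasureTheory

namespace PQ

noncomputable section

/-- `C` shatters the finite set `A`: every labelling of `A` is realised by a member of `C`. -/
def Shatters {X : Type*} (C : Set (X → Bool)) (A : Finset X) : Prop :=
  ∀ g : X → Bool, ∃ c ∈ C, ∀ a ∈ A, c a = g a

/-- The Vapnik-Chervonenkis dimension of a class of binary classifiers (possibly infinite). -/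
def vcDim {X : Type*} (C : Set (X → Bool)) : ℕ∞ :=
  ⨆ (A : Finset X) (_ : Shatters C A), (A.card : ℕ∞)

/-- Rejection rate of the selection set `S` on the distribution `D`. -/
def rej {X : Type*} [MeasurableSpace X] (D : Measure X) (S : Set X) : ℝ :=
  D.real {x | x ∉ S}

/-- Error rate on `D` of the selective classifier `h|_S` with respect to the target `f`. -/
def err {X : Type*} [MeasurableSpace X] (D : Measure X) (f h : X → Bool) (S : Set X) : ℝ :=
  D.real {x | h x ≠ f x ∧ x ∈ S}

open Classical in
/-- Empirical error of the selective classifier `h|_S` with respect to `g` on the sample `z`. -/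
def empErr {X : Type*} {n : ℕ} (z : Fin n → X) (h : X → Bool) (S : Set X) (g : X → Bool) : ℝ :=
  (1 / (n : ℝ)) * (Finset.univ.filter fun i => g (z i) ≠ h (z i) ∧ z i ∈ S).card

/-- Number of mistakes of `c` on a list of labelled examples. -/
def mistakes {X : Type*} (c : X → Bool) (data : List (X × Bool)) : ℕ :=
  data.countP fun p => c p.1 != p.2

/-- `erm` is a (deterministic) empirical risk minimization oracle for `C`: on any list of labelled
examples it returns a member of `C` with the fewest mistakes. -/
def IsERM {X : Type*} (C : Set (X → Bool)) (erm : List (X × Bool) → X → Bool) : Prop :=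
  ∀ data, erm data ∈ C ∧ ∀ c ∈ C, mistakes (erm data) data ≤ mistakes c data

/-- The set of points on which `h` and all the classifiers in the list `cs` agree. -/
def agreeSet {X : Type*} (h : X → Bool) (cs : List (X → Bool)) : Set X :=
  {x | ∀ c ∈ cs, c x = h x}

/-- The objective `s_t(c)` of an iteration, for train sample `x`, test sample `x'` and current
selection set `S = S_t`. -/
def score {X : Type*} {n : ℕ} (Λ : ℝ) (x x' : Fin n → X) (h : X → Bool) (S : Set X)
    (c : X → Bool) : ℝ :=
  empErr x' h S c - Λ * empErr x h Set.univ c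

/-- A deterministic rule for the choices made in the loop. Its arguments are the train sample, the
test sample, the classifier `h`, and the list `c_1, …, c_{t-1}` of the earlier choices; its value
is the choice `c_t`. -/
abbrev Rule (X : Type*) (n : ℕ) : Type _ :=
  (Fin n → X) → (Fin n → X) → (X → Bool) → List (X → Bool) → (X → Bool)

/-- The rule always picks a maximizer over `C` of the current objective (ties being broken in an
arbitrary way, and by an arbitrary implementation). -/
def IsMaximizing {X : Type*} {n : ℕ} (C : Set (X → Bool)) (Λ : ℝ) (pick : Rule X n) : Prop :=
  ∀ x x' h cs, pick x x' h cs ∈ C ∧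
    ∀ c ∈ C, score Λ x x' h (agreeSet h cs) c ≤ score Λ x x' h (agreeSet h cs) (pick x x' h cs)

/-- The list `c_1, …, c_t` of the first `t` choices. -/
def choices {X : Type*} {n : ℕ} (pick : Rule X n) (x x' : Fin n → X) (h : X → Bool) :
    ℕ → List (X → Bool)
  | 0 => []
  | t + 1 => choices pick x x' h t ++ [pick x x' h (choices pick x x' h t)]

/-- The stopping test passes right after `t` unsuccessful iterations, i.e. in iteration `t + 1`,
where the current selection set is the agreement set of `h, c_1, …, c_t`. -/
def Stops {X : Type*} {n : ℕ} (pick : Rule X n) (Λ ε : ℝ) (x x' : Fin n → X) (h : X → Bool)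
    (t : ℕ) : Prop :=
  score Λ x x' h (agreeSet h (choices pick x x' h t))
    (pick x x' h (choices pick x x' h t)) ≤ ε

open Classical in
/-- The algorithm Rejectron, on train sample `x` with labels `y`, test sample `x'`, error
parameter `ε` and weight `Λ`. It is a partial value: it is defined if and only if the loop halts,
and then it is the pair `(h, S)` returned in the first iteration that passes the stopping test. -/
def rejectron {X : Type*} {n : ℕ} (erm : List (X × Bool) → X → Bool) (pick : Rule X n)
    (Λ : ℝ) (x : Fin n → X) (y : Fin n → Bool) (x' : Fin n → X) (ε : ℝ) :
    Part ((X → Bool) × Set X) :=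
  let h := erm (List.ofFn fun i => (x i, y i))
  ⟨∃ t, Stops pick Λ ε x x' h t, fun H => (h, agreeSet h (choices pick x x' h (Nat.find H)))⟩

/-- The value of the error parameter that balances errors and rejections. -/
def epsStar (d n : ℕ) (δ : ℝ) : ℝ :=
  √(8 * d * Real.log (2 * n) / n) + 8 * Real.log (16 / δ) / n

end

end PQ

/-!
Each unsuccessful iteration of Rejectron rejects more than an `ε` fraction of the test points, so
there are at most `1 / ε` of them. A disagreement with `h` on a single training point costs
`Λ / n ≥ 1` in the objective, so no training point is ever rejected; and since `f` itself is a
candidate for the choices `c_t`, the empirical test error is at most `ε` on halting. The region that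
the output `h|_S` rejects is determined by at most `1 / ε + 1` members of `C`, and, once `h` is
known, the region on which it errs by at most `1 / ε` of them; by Sauer-Shelah, these regions have
only polynomially many traces on a double sample.

Both generalization bounds come from one symmetrization. Give a trace on `n` sample and `n` ghost
points the weight `β ^ (sample hits) * α ^ (ghost hits)`, where `α + β = 2`. Averaged over all
exchanges of sample and ghost points within the pairs this is at most `1`, so the expected sum of
the weights over all traces is at most their number, and Markov's inequality applies to its
conditional expectation given the sample. The weights `(2, 0)` handle regions that miss the sample
(rejections), and `(4 / 3, 2 / 3)` regions that are hit by at most an `ε` fraction of it (errors).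
-/

namespace PQ

variable {X : Type*} {C : Set (X → Bool)}

section Growth

variable {𝒢 ℋ : Set (X → Bool)} {d m : ℕ}

/-- The growth function of a class of binary functions: the largest number of distinct restrictions
of its members to a set of at most `m` points. It is `ℕ∞`-valued, so that no finiteness has to be
carried around. -/
noncomputable def growth (𝒢 : Set (X → Bool)) (m : ℕ) : ℕ∞ :=
  ⨆ (A : Finset X) (_ : A.card ≤ m), (A.restrict '' 𝒢).encard

theorem encard_restrict_le_growth {A : Finset X} (hA : A.card ≤ m) :
    (A.restrict '' 𝒢).encard ≤ growth 𝒢 m :=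
  le_iSup₂ (f := fun (A : Finset X) (_ : A.card ≤ m) => (A.restrict '' 𝒢).encard) A hA

theorem growth_mono (h : 𝒢 ⊆ ℋ) (m : ℕ) : growth 𝒢 m ≤ growth ℋ m :=
  iSup₂_mono fun _ _ => Set.encard_le_encard (Set.image_mono h)

theorem card_le_of_shatters (hd : vcDim C ≤ d) {A : Finset X} (hA : Shatters C A) : A.card ≤ d :=
  Nat.cast_le.1 <|
    (le_iSup₂ (f := fun (A : Finset X) (_ : Shatters C A) => (A.card : ℕ∞)) A hA).trans hd

theorem sum_range_choose_le_pow (m d : ℕ) :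
    ∑ k ∈ Finset.range (d + 1), m.choose k ≤ (m + 1) ^ d := by
  induction d with
  | zero => simp
  | succ d ih =>
    calc ∑ k ∈ Finset.range (d + 2), m.choose k
        = ∑ k ∈ Finset.range (d + 1), m.choose k + m.choose (d + 1) := Finset.sum_range_succ ..
      _ ≤ (m + 1) ^ d + m ^ (d + 1) := add_le_add ih (Nat.choose_le_pow _ _)
      _ = (m + 1) ^ d + m * m ^ d := by rw [pow_succ']
      _ ≤ (m + 1) ^ d + m * (m + 1) ^ d := by gcongr; exact m.le_succ
      _ = (m + 1) ^ (d + 1) := by ring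

open Classical in
/-- The subsets of `A` cut out by the members of `C`: the restrictions of `C` to `A` as a set
family, to which the Sauer-Shelah theory of set families applies. -/
noncomputable def cuts (C : Set (X → Bool)) (A : Finset X) : Finset (Finset X) :=
  A.powerset.filter fun s => ∃ c ∈ C, A.filter (fun a => c a = true) = s

theorem mem_cuts {A s : Finset X} :
    s ∈ cuts C A ↔ ∃ c ∈ C, A.filter (fun a => c a = true) = s := by
  simp only [cuts, Finset.mem_filter, Finset.mem_powerset, and_iff_right_iff_imp]
  rintro ⟨c, -, rfl⟩
  exact Finset.filter_subset _ _

theorem encard_restrict_le_card_cuts (C : Set (X → Bool)) (A : Finset X) :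
    (A.restrict '' C).encard ≤ (cuts C A).card := by
  classical
  have hsub : A.restrict '' C ⊆
      (fun s (a : A) => decide (a.1 ∈ s)) '' (cuts C A : Set (Finset X)) := by
    rintro _ ⟨c, hc, rfl⟩
    refine ⟨A.filter fun a => c a = true, mem_cuts.2 ⟨c, hc, rfl⟩, ?_⟩
    ext a
    simp
  calc (A.restrict '' C).encard ≤ (cuts C A : Set (Finset X)).encard :=
        (Set.encard_le_encard hsub).trans (Set.encard_image_le _ _)
    _ = (cuts C A).card := Set.encard_coe_eq_coe_finsetCard _

theorem shatters_of_cuts_shatters [DecidableEq X] {A s : Finset X} (hs : (cuts C A).Shatters s) :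
    s ⊆ A ∧ Shatters C s := by
  obtain ⟨t, ht, hst⟩ := hs.exists_superset
  obtain ⟨c, -, rfl⟩ := mem_cuts.1 ht
  have hsA : s ⊆ A := hst.trans (Finset.filter_subset _ _)
  refine ⟨hsA, fun g => ?_⟩
  obtain ⟨u, hu, hsu⟩ := hs (Finset.filter_subset (fun a => g a = true) s)
  obtain ⟨c, hc, rfl⟩ := mem_cuts.1 hu
  refine ⟨c, hc, fun a ha => Bool.eq_iff_iff.2 ?_⟩
  simpa [ha, hsA ha] using Finset.ext_iff.1 hsu a

theorem card_cuts_le (hd : vcDim C ≤ d) (A : Finset X) : (cuts C A).card ≤ (A.card + 1) ^ d := by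
  classical
  have hsub : (cuts C A).shatterer ⊆
      (Finset.range (d + 1)).biUnion fun k => A.powersetCard k := fun s hs => by
    obtain ⟨hsA, hsC⟩ := shatters_of_cuts_shatters (Finset.mem_shatterer.1 hs)
    simpa [hsA] using card_le_of_shatters hd hsC
  calc (cuts C A).card ≤ (cuts C A).shatterer.card := Finset.card_le_card_shatterer _
    _ ≤ ∑ k ∈ Finset.range (d + 1), (A.powersetCard k).card :=
      (Finset.card_le_card hsub).trans Finset.card_biUnion_le
    _ = ∑ k ∈ Finset.range (d + 1), A.card.choose k := by simp only [Finset.card_powersetCard]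
    _ ≤ (A.card + 1) ^ d := sum_range_choose_le_pow _ _

theorem growth_le_of_vcDim_le (hd : vcDim C ≤ d) (m : ℕ) : growth C m ≤ ((m + 1) ^ d : ℕ) := by
  refine iSup₂_le fun A hA => (encard_restrict_le_card_cuts C A).trans (Nat.cast_le.2 ?_)
  calc (cuts C A).card ≤ (A.card + 1) ^ d := card_cuts_le hd A
    _ ≤ (m + 1) ^ d := by gcongr

theorem growth_image_pi_le {κ : Type*} [Fintype κ] (C : Set (X → Bool))
    (ψ : X → (κ → Bool) → Bool) (m : ℕ) :
    growth ((fun (c : κ → X → Bool) x => ψ x fun k => c k x) '' Set.univ.pi fun _ => C) m ≤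
      growth C m ^ Fintype.card κ := by
  refine iSup₂_le fun A hA => ?_
  have hsub : A.restrict '' ((fun (c : κ → X → Bool) x => ψ x fun k => c k x) ''
      Set.univ.pi fun _ => C) ⊆
      (fun (t : κ → A → Bool) a => ψ a fun k => t k a) '' Set.univ.pi fun _ => A.restrict '' C := by
    rintro _ ⟨_, ⟨c, hc, rfl⟩, rfl⟩
    exact ⟨fun k => A.restrict (c k), fun k hk => ⟨c k, hc k hk, rfl⟩, rfl⟩
  calc _ ≤ (Set.univ.pi fun _ : κ => A.restrict '' C).encard :=
        (Set.encard_le_encard hsub).trans (Set.encard_image_le _ _)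
    _ = (A.restrict '' C).encard ^ Fintype.card κ := by
        rw [Set.encard_pi_eq_prod_encard, Finset.prod_const, Finset.card_univ]
    _ ≤ growth C m ^ Fintype.card κ := pow_le_pow_left' (encard_restrict_le_growth hA) _

end Growth

section Agreement

/-- The indicator functions of the rejection regions of agreement sets built from a member of `C`
and at most `K` further members. -/
def rejectionClass (C : Set (X → Bool)) (K : ℕ) : Set (X → Bool) :=
  open Classical in
  {g | ∃ h ∈ C, ∃ cs : List (X → Bool), (∀ c ∈ cs, c ∈ C) ∧ cs.length ≤ K ∧
    g = fun u => decide (u ∉ agreeSet h cs)}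

/-- The indicator functions of the regions on which a selective classifier `h|_S` errs with respect
to `f`, where `S` is the agreement set of `h` and at most `K` members of `C`. -/
def errorClass (C : Set (X → Bool)) (h f : X → Bool) (K : ℕ) : Set (X → Bool) :=
  open Classical in
  {g | ∃ cs : List (X → Bool), (∀ c ∈ cs, c ∈ C) ∧ cs.length ≤ K ∧
    g = fun u => decide (h u ≠ f u ∧ u ∈ agreeSet h cs)}

theorem exists_fin_family_agreeSet_eq {h : X → Bool} (hh : h ∈ C) {cs : List (X → Bool)}
    (hcs : ∀ c ∈ cs, c ∈ C) {K : ℕ} (hK : cs.length ≤ K) :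
    ∃ c : Fin K → X → Bool, (∀ k, c k ∈ C) ∧ agreeSet h cs = {u | ∀ k, c k u = h u} := by
  -- Padding with `h` itself does not change the agreement set.
  have hpad : ∀ k, cs.getD k h ∈ cs ∨ cs.getD k h = h := fun k => by
    rcases lt_or_ge k cs.length with hk | hk
    · exact .inl (by simp [hk])
    · exact .inr (by simp [hk])
  refine ⟨fun k => cs.getD k h, fun k => ?_, Set.Subset.antisymm (fun u hu k => ?_) ?_⟩
  · exact (hpad k).elim (hcs _) fun hk => Set.mem_of_eq_of_mem hk hh
  · exact (hpad k).elim (hu _) (congrFun · u)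
  · intro u hu c hc
    obtain ⟨k, hk, rfl⟩ := List.getElem_of_mem hc
    simpa [hk] using hu ⟨k, hk.trans_le hK⟩

theorem growth_rejectionClass_le (C : Set (X → Bool)) (K m : ℕ) :
    growth (rejectionClass C K) m ≤ growth C m ^ (K + 1) := by
  classical
  have hsub : rejectionClass C K ⊆
      (fun (c : Option (Fin K) → X → Bool) x => decide (∃ k, c (some k) x ≠ c none x)) ''
        Set.univ.pi fun _ => C := by
    rintro _ ⟨h, hh, cs, hcs, hK, rfl⟩
    obtain ⟨c, hc, hagree⟩ := exists_fin_family_agreeSet_eq hh hcs hK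
    refine ⟨fun k => k.elim h c, fun k _ => by cases k <;> simp [hh, hc], ?_⟩
    exact funext fun u => decide_eq_decide.2 (by simp [hagree])
  simpa using (growth_mono hsub m).trans
    (growth_image_pi_le C (fun _ v => decide (∃ k, v (some k) ≠ v none)) m)

theorem growth_errorClass_le {h : X → Bool} (hh : h ∈ C) (f : X → Bool) (K m : ℕ) :
    growth (errorClass C h f K) m ≤ growth C m ^ K := by
  classical
  have hsub : errorClass C h f K ⊆
      (fun (c : Fin K → X → Bool) x => decide (h x ≠ f x ∧ ∀ k, c k x = h x)) ''
        Set.univ.pi fun _ => C := by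
    rintro _ ⟨cs, hcs, hK, rfl⟩
    obtain ⟨c, hc, hagree⟩ := exists_fin_family_agreeSet_eq hh hcs hK
    exact ⟨c, fun k _ => hc k, by simp [hagree]⟩
  simpa using (growth_mono hsub m).trans
    (growth_image_pi_le C (fun x v => decide (h x ≠ f x ∧ ∀ k, v k = h x)) m)

end Agreement

section Symmetrization

variable {ι Y : Type*} {α β : ℝ}

/-- The double sample `w` with sample and ghost point exchanged in the pairs selected by `σ`. -/
def swapOn (σ : ι → Bool) (w : ι → Y × Y) : ι → Y × Y :=
  fun i => bif σ i then (w i).swap else w i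

theorem swapOn_map (g : X → Bool) (σ : ι → Bool) (w : ι → X × X) :
    (fun i => (swapOn σ w i).map g g) = swapOn σ fun i => (w i).map g g := by
  funext i
  cases h : σ i <;> simp [swapOn, h, Prod.map, Prod.swap]

theorem swapOn_injective (σ : ι → Bool) : Function.Injective (swapOn σ : (ι → Y × Y) → _) := by
  refine Function.LeftInverse.injective (g := swapOn σ) fun w => funext fun i => ?_
  cases h : σ i <;> simp [swapOn, h]

variable [Fintype ι]

/-- The weight of the pair (sample point hit, ghost point hit): a hit of the sample counts `β`, a
hit of the ghost sample counts `α`. -/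
def pairWeight (α β : ℝ) (t : Bool × Bool) : ℝ :=
  (bif t.1 then β else 1) * bif t.2 then α else 1

/-- The weight of a trace on a double sample: the product of the weights of its pairs. -/
def weight (α β : ℝ) (t : ι → Bool × Bool) : ℝ :=
  ∏ i, pairWeight α β (t i)

theorem pairWeight_nonneg (hα : 0 ≤ α) (hβ : 0 ≤ β) (t : Bool × Bool) : 0 ≤ pairWeight α β t := by
  obtain ⟨_ | _, _ | _⟩ := t <;> simp [pairWeight, hα, hβ, mul_nonneg]

theorem weight_nonneg (hα : 0 ≤ α) (hβ : 0 ≤ β) (t : ι → Bool × Bool) : 0 ≤ weight α β t :=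
  Finset.prod_nonneg fun _ _ => pairWeight_nonneg hα hβ _

theorem pairWeight_swap_add_le (hαβ : α + β = 2) (t : Bool × Bool) :
    pairWeight α β t.swap + pairWeight α β t ≤ 2 := by
  obtain ⟨_ | _, _ | _⟩ := t <;> simp [pairWeight] <;> nlinarith [sq_nonneg (α - β)]

theorem sum_weight_swapOn_le [DecidableEq ι] (hα : 0 ≤ α) (hβ : 0 ≤ β) (hαβ : α + β = 2)
    (t : ι → Bool × Bool) :
    ∑ σ : ι → Bool, weight α β (swapOn σ t) ≤ 2 ^ Fintype.card ι := by
  calc ∑ σ : ι → Bool, weight α β (swapOn σ t)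
      = ∏ i, ∑ b : Bool, pairWeight α β (bif b then (t i).swap else t i) := by
        rw [Finset.prod_univ_sum, Fintype.piFinset_univ]
        rfl
    _ = ∏ i, (pairWeight α β (t i).swap + pairWeight α β (t i)) := by
        simp only [Fintype.sum_bool, cond_true, cond_false]
    _ ≤ ∏ _ : ι, 2 := Finset.prod_le_prod
        (fun i _ => add_nonneg (pairWeight_nonneg hα hβ _) (pairWeight_nonneg hα hβ _))
        fun i _ => pairWeight_swap_add_le hαβ (t i)
    _ = 2 ^ Fintype.card ι := by rw [Finset.prod_const, Finset.card_univ]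

/-- The traces of the members of `𝒢` on the double sample `w`. -/
noncomputable def pairTraces (𝒢 : Set (X → Bool)) (w : ι → X × X) : Finset (ι → Bool × Bool) :=
  (Set.toFinite ((fun g i => (w i).map g g) '' 𝒢)).toFinset

theorem mem_pairTraces {𝒢 : Set (X → Bool)} {w : ι → X × X} {t : ι → Bool × Bool} :
    t ∈ pairTraces 𝒢 w ↔ ∃ g ∈ 𝒢, (fun i => (w i).map g g) = t := by
  simp only [pairTraces, Set.Finite.mem_toFinset, Set.mem_image]

theorem card_pairTraces_le {𝒢 : Set (X → Bool)} {M : ℕ} (hM : growth 𝒢 (2 * Fintype.card ι) ≤ M)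
    (w : ι → X × X) : (pairTraces 𝒢 w).card ≤ M := by
  classical
  let A : Finset X :=
    (Finset.univ.image fun i => (w i).1) ∪ Finset.univ.image fun i => (w i).2
  have hA : A.card ≤ 2 * Fintype.card ι := by
    rw [two_mul]
    exact (Finset.card_union_le _ _).trans (add_le_add Finset.card_image_le Finset.card_image_le)
  have hw : ∀ i, (w i).1 ∈ A ∧ (w i).2 ∈ A := fun i => by simp [A]
  have hsub : (pairTraces 𝒢 w : Set (ι → Bool × Bool)) ⊆
      (fun (r : A → Bool) i => (r ⟨(w i).1, (hw i).1⟩, r ⟨(w i).2, (hw i).2⟩)) ''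
        (A.restrict '' 𝒢) := by
    intro t ht
    obtain ⟨g, hg, rfl⟩ := mem_pairTraces.1 ht
    exact ⟨A.restrict g, ⟨g, hg, rfl⟩, rfl⟩
  refine (Nat.cast_le (α := ℕ∞)).1 ?_
  calc ((pairTraces 𝒢 w).card : ℕ∞)
      = (pairTraces 𝒢 w : Set (ι → Bool × Bool)).encard :=
        (Set.encard_coe_eq_coe_finsetCard _).symm
    _ ≤ (A.restrict '' 𝒢).encard := (Set.encard_le_encard hsub).trans (Set.encard_image_le _ _)
    _ ≤ M := (encard_restrict_le_growth hA).trans hM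

/-- The total weight of the traces of `𝒢` on a double sample. -/
noncomputable def totalWeight (α β : ℝ) (𝒢 : Set (X → Bool)) (w : ι → X × X) : ℝ :=
  ∑ t ∈ pairTraces 𝒢 w, weight α β t

theorem weight_le_totalWeight (hα : 0 ≤ α) (hβ : 0 ≤ β) {𝒢 : Set (X → Bool)} {g : X → Bool}
    (hg : g ∈ 𝒢) (w : ι → X × X) : weight α β (fun i => (w i).map g g) ≤ totalWeight α β 𝒢 w :=
  Finset.single_le_sum (f := weight α β) (fun _ _ => weight_nonneg hα hβ _)
    (mem_pairTraces.2 ⟨g, hg, rfl⟩)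

theorem totalWeight_nonneg (hα : 0 ≤ α) (hβ : 0 ≤ β) (𝒢 : Set (X → Bool)) (w : ι → X × X) :
    0 ≤ totalWeight α β 𝒢 w :=
  Finset.sum_nonneg fun _ _ => weight_nonneg hα hβ _

theorem totalWeight_swapOn (𝒢 : Set (X → Bool)) (σ : ι → Bool) (w : ι → X × X) :
    totalWeight α β 𝒢 (swapOn σ w) = ∑ t ∈ pairTraces 𝒢 w, weight α β (swapOn σ t) := by
  classical
  have htraces : pairTraces 𝒢 (swapOn σ w) = (pairTraces 𝒢 w).image (swapOn σ) := by
    ext t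
    simp only [mem_pairTraces, Finset.mem_image, swapOn_map, exists_exists_and_eq_and]
  rw [totalWeight, htraces, Finset.sum_image (swapOn_injective σ).injOn]

theorem sum_totalWeight_swapOn_le [DecidableEq ι] (hα : 0 ≤ α) (hβ : 0 ≤ β)
    (hαβ : α + β = 2) {𝒢 : Set (X → Bool)} {M : ℕ} (hM : growth 𝒢 (2 * Fintype.card ι) ≤ M)
    (w : ι → X × X) :
    ∑ σ : ι → Bool, totalWeight α β 𝒢 (swapOn σ w) ≤ M * 2 ^ Fintype.card ι := by
  calc ∑ σ : ι → Bool, totalWeight α β 𝒢 (swapOn σ w)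
      = ∑ t ∈ pairTraces 𝒢 w, ∑ σ : ι → Bool, weight α β (swapOn σ t) := by
        simp only [totalWeight_swapOn]
        exact Finset.sum_comm
    _ ≤ ∑ _ ∈ pairTraces 𝒢 w, 2 ^ Fintype.card ι :=
        Finset.sum_le_sum fun t _ => sum_weight_swapOn_le hα hβ hαβ t
    _ = (pairTraces 𝒢 w).card * 2 ^ Fintype.card ι := by rw [Finset.sum_const, nsmul_eq_mul]
    _ ≤ M * 2 ^ Fintype.card ι := by gcongr; exact card_pairTraces_le hM w

theorem integrable_totalWeight (hα : 0 ≤ α) (hβ : 0 ≤ β) (𝒢 : Set (X → Bool))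
    [Countable Y] [MeasurableSpace Y] [DiscreteMeasurableSpace Y] (μ : Measure Y)
    [IsFiniteMeasure μ] (w : Y → ι → X × X) : Integrable (fun y => totalWeight α β 𝒢 (w y)) μ := by
  classical
  refine Integrable.of_bound AEStronglyMeasurable.of_discrete
    (∑ t : ι → Bool × Bool, weight α β t) (.of_forall fun y => ?_)
  rw [Real.norm_of_nonneg (totalWeight_nonneg hα hβ 𝒢 (w y))]
  exact Finset.sum_le_sum_of_subset_of_nonneg (Finset.subset_univ _)
    fun t _ _ => weight_nonneg hα hβ t

variable [MeasurableSpace X]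

theorem measurePreserving_swapOn (P : Measure X) [SigmaFinite P] (σ : ι → Bool) :
    MeasurePreserving (swapOn σ) (Measure.pi fun _ : ι => P.prod P)
      (Measure.pi fun _ => P.prod P) := by
  have hpair : ∀ b : Bool, MeasurePreserving (fun p : X × X => bif b then p.swap else p)
      (P.prod P) (P.prod P)
    | true => Measure.measurePreserving_swap
    | false => MeasurePreserving.id _
  exact measurePreserving_pi _ _ fun i => hpair (σ i)

variable [DiscreteMeasurableSpace X]

theorem integral_cond_one (P : Measure X) [IsProbabilityMeasure P] (G : X → Bool) (a : ℝ) :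
    ∫ u, (bif G u then a else 1) ∂P = 1 + (a - 1) * P.real {u | G u = true} := by
  have hcond : ∀ u, (bif G u then a else 1) =
      1 + {u | G u = true}.indicator (fun _ => a - 1) u := fun u => by
    by_cases h : G u = true <;> simp [h]
  have hs : MeasurableSet {u | G u = true} := MeasurableSet.of_discrete
  simp only [hcond]
  rw [integral_add (integrable_const _) ((integrable_const _).indicator hs),
    integral_indicator_const _ hs, integral_const, probReal_univ, smul_eq_mul, smul_eq_mul,
    one_mul, mul_comm]

/-- The number of sample points at which `G` is `true`. -/
def hits (G : X → Bool) (x : ι → X) : ℕ :=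
  (Finset.univ.filter fun i => G (x i) = true).card

theorem integral_weight (P : Measure X) [IsProbabilityMeasure P] (G : X → Bool) (x : ι → X) :
    ∫ x' : ι → X, weight α β (fun i => (G (x i), G (x' i))) ∂(Measure.pi fun _ => P) =
      β ^ hits G x * (1 + (α - 1) * P.real {u | G u = true}) ^ Fintype.card ι := by
  have hsample : (∏ i, bif G (x i) then β else 1) = β ^ hits G x := by
    simp only [Bool.cond_eq_ite, Finset.prod_ite, Finset.prod_const, one_pow, mul_one, hits]
  have hghost : ∫ x' : ι → X, ∏ i, (bif G (x' i) then α else 1) ∂(Measure.pi fun _ => P) =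
      (1 + (α - 1) * P.real {u | G u = true}) ^ Fintype.card ι := by
    rw [integral_fintype_prod_eq_prod (fun (_ : ι) (u : X) => bif G u then α else 1),
      integral_cond_one, Finset.prod_const, Finset.card_univ]
  simp only [weight, pairWeight, Finset.prod_mul_distrib, integral_const_mul, hsample, hghost]

variable [Countable X]

theorem integral_totalWeight_le (hα : 0 ≤ α) (hβ : 0 ≤ β) (hαβ : α + β = 2)
    {𝒢 : Set (X → Bool)} {M : ℕ} (hM : growth 𝒢 (2 * Fintype.card ι) ≤ M)
    (P : Measure X) [IsProbabilityMeasure P] :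
    ∫ w, totalWeight α β 𝒢 w ∂(Measure.pi fun _ : ι => P.prod P) ≤ M := by
  classical
  set μ := Measure.pi fun _ : ι => P.prod P
  have hintσ (σ : ι → Bool) : Integrable (fun w => totalWeight α β 𝒢 (swapOn σ w)) μ :=
    integrable_totalWeight hα hβ 𝒢 μ (swapOn σ)
  have hinv (σ : ι → Bool) :
      ∫ w, totalWeight α β 𝒢 (swapOn σ w) ∂μ = ∫ w, totalWeight α β 𝒢 w ∂μ := by
    have hσ := measurePreserving_swapOn P σ
    rw [← integral_map hσ.aemeasurable AEStronglyMeasurable.of_discrete, hσ.map_eq]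
  refine le_of_mul_le_mul_right ?_ (show (0 : ℝ) < 2 ^ Fintype.card ι by positivity)
  calc (∫ w, totalWeight α β 𝒢 w ∂μ) * 2 ^ Fintype.card ι
      = ∑ σ : ι → Bool, ∫ w, totalWeight α β 𝒢 (swapOn σ w) ∂μ := by
        simp only [hinv, Finset.sum_const, Finset.card_univ, Fintype.card_fun, Fintype.card_bool,
          nsmul_eq_mul, Nat.cast_pow, Nat.cast_ofNat, mul_comm]
    _ = ∫ w, ∑ σ : ι → Bool, totalWeight α β 𝒢 (swapOn σ w) ∂μ :=
        (integral_finsetSum _ fun σ _ => hintσ σ).symm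
    _ ≤ ∫ _, (M * 2 ^ Fintype.card ι : ℝ) ∂μ :=
        integral_mono (integrable_finsetSum _ fun σ _ => hintσ σ) (integrable_const _)
          (sum_totalWeight_swapOn_le hα hβ hαβ hM)
    _ = M * 2 ^ Fintype.card ι := by rw [integral_const, probReal_univ, one_smul]

theorem one_sub_le_measureReal_forall_lt (hα : 0 ≤ α) (hβ : 0 ≤ β) (hαβ : α + β = 2)
    {𝒢 : Set (X → Bool)} {M : ℕ} (hM : growth 𝒢 (2 * Fintype.card ι) ≤ M)
    (P : Measure X) [IsProbabilityMeasure P] {δ R : ℝ} (hR : 0 < R) (hMR : M ≤ δ * R) :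
    1 - δ ≤ (Measure.pi fun _ : ι => P).real {x | ∀ G ∈ 𝒢,
      β ^ hits G x * (1 + (α - 1) * P.real {u | G u = true}) ^ Fintype.card ι < R} := by
  set μ := Measure.pi fun _ : ι => P
  let ghostMean : (ι → X) → ℝ := fun x => ∫ x', totalWeight α β 𝒢 (fun i => (x i, x' i)) ∂μ
  have hmp := (measurePreserving_arrowProdEquivProdArrow X X ι (fun _ => P) fun _ => P).symm
  have hint : Integrable (fun z : (ι → X) × (ι → X) =>
      totalWeight α β 𝒢 fun i => (z.1 i, z.2 i)) (μ.prod μ) :=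
    integrable_totalWeight hα hβ 𝒢 _ _
  have hmean : ∫ x, ghostMean x ∂μ ≤ M := by
    rw [← integral_prod _ hint]
    exact (hmp.integral_comp' (totalWeight α β 𝒢)).trans_le
      (integral_totalWeight_le hα hβ hαβ hM P)
  have hdom : ∀ x, ∀ G ∈ 𝒢,
      β ^ hits G x * (1 + (α - 1) * P.real {u | G u = true}) ^ Fintype.card ι ≤ ghostMean x :=
    fun x G hG => by
      rw [← integral_weight]
      exact integral_mono_of_nonneg (.of_forall fun _ => weight_nonneg hα hβ _)
        (integrable_totalWeight hα hβ 𝒢 _ _)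
        (.of_forall fun x' => weight_le_totalWeight hα hβ hG fun i => (x i, x' i))
  have hmarkov : R * μ.real {x | R ≤ ghostMean x} ≤ M :=
    (mul_meas_ge_le_integral_of_nonneg (.of_forall fun x => integral_nonneg fun x' =>
      totalWeight_nonneg hα hβ 𝒢 _) hint.integral_prod_left R).trans hmean
  have hbad : μ.real {x | R ≤ ghostMean x} ≤ δ :=
    le_of_mul_le_mul_left (hmarkov.trans (hMR.trans_eq (mul_comm δ R))) hR
  calc 1 - δ ≤ 1 - μ.real {x | R ≤ ghostMean x} := by gcongr
    _ = μ.real {x | R ≤ ghostMean x}ᶜ := (probReal_compl_eq_one_sub MeasurableSet.of_discrete).symm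
    _ ≤ _ := measureReal_mono fun x hx G hG => (hdom x G hG).trans_lt (not_le.1 hx)

theorem rpow_le_one_add_pow {p q : ℝ} (hα : 1 ≤ α) (hq : q ≤ p) (hp0 : 0 ≤ p) (hp1 : p ≤ 1)
    (n : ℕ) : α ^ (n * q) ≤ (1 + (α - 1) * p) ^ n := by
  have hbernoulli : α ^ p ≤ 1 + (α - 1) * p := by
    simpa [mul_comm] using
      rpow_one_add_le_one_add_mul_self (s := α - 1) (by linarith) hp0 hp1
  calc α ^ (n * q) ≤ α ^ (n * p) := by gcongr
    _ = (α ^ p) ^ n := by rw [mul_comm, Real.rpow_mul_natCast (by linarith)]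
    _ ≤ (1 + (α - 1) * p) ^ n := by gcongr

theorem one_sub_le_measureReal_forall_consistent {𝒢 : Set (X → Bool)} {M : ℕ}
    (hM : growth 𝒢 (2 * Fintype.card ι) ≤ M) (P : Measure X) [IsProbabilityMeasure P] {δ γ : ℝ}
    (hMγ : M ≤ δ * 2 ^ (Fintype.card ι * γ)) :
    1 - δ ≤ (Measure.pi fun _ : ι => P).real
      {x | ∀ G ∈ 𝒢, (∀ i, G (x i) = false) → P.real {u | G u = true} ≤ γ} := by
  refine (one_sub_le_measureReal_forall_lt (α := 2) (β := 0) (by norm_num) le_rfl (by norm_num) hM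
    P (by positivity) hMγ).trans (measureReal_mono fun x hx G hG hGx => ?_)
  have hhits : hits G x = 0 := by simp [hits, hGx]
  by_contra! hlt
  refine (hx G hG).not_ge ?_
  rw [hhits, pow_zero, one_mul]
  exact rpow_le_one_add_pow one_le_two hlt.le measureReal_nonneg measureReal_le_one _

/-- With weights `α = 4/3` and `β = 2/3`, a set of measure more than `2ε` that is hit at most an
`ε` fraction of the time has weight `β ^ (nε) * α ^ (2nε) = (32/27) ^ (nε)`. -/
theorem one_sub_le_measureReal_forall_hits_le {𝒢 : Set (X → Bool)} {M : ℕ}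
    (hM : growth 𝒢 (2 * Fintype.card ι) ≤ M) (P : Measure X) [IsProbabilityMeasure P] {δ ε : ℝ}
    (hMε : M ≤ δ * (32 / 27) ^ (Fintype.card ι * ε)) :
    1 - δ ≤ (Measure.pi fun _ : ι => P).real
      {x | ∀ G ∈ 𝒢, hits G x ≤ Fintype.card ι * ε → P.real {u | G u = true} ≤ 2 * ε} := by
  refine (one_sub_le_measureReal_forall_lt (α := 4 / 3) (β := 2 / 3) (by norm_num) (by norm_num)
    (by norm_num) hM P (by positivity) hMε).trans (measureReal_mono fun x hx G hG hGx => ?_)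
  by_contra! hlt
  refine (hx G hG).not_ge ?_
  set n := Fintype.card ι
  have hsample : (2 / 3 : ℝ) ^ (n * ε) ≤ (2 / 3) ^ hits G x := by
    rw [← Real.rpow_natCast]
    exact Real.rpow_le_rpow_of_exponent_ge (by norm_num) (by norm_num) hGx
  have hghost : (4 / 3 : ℝ) ^ (n * (2 * ε)) ≤ (1 + (4 / 3 - 1) * P.real {u | G u = true}) ^ n :=
    rpow_le_one_add_pow (by norm_num) hlt.le measureReal_nonneg measureReal_le_one n
  calc (32 / 27 : ℝ) ^ (n * ε) = (2 / 3) ^ (n * ε) * ((4 / 3) ^ (2 : ℝ)) ^ (n * ε) := by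
        rw [← Real.mul_rpow (by norm_num) (by positivity)]
        norm_num
    _ = (2 / 3) ^ (n * ε) * (4 / 3) ^ (n * (2 * ε)) := by
        rw [← Real.rpow_mul (by norm_num), mul_left_comm]
    _ ≤ _ := by gcongr

end Symmetrization

section Rejectron

variable {n : ℕ} {Λ ε : ℝ} {pick : Rule X n} {x x' : Fin n → X} {h f : X → Bool}

theorem mistakes_eq_zero_iff {c : X → Bool} {l : List (X × Bool)} :
    mistakes c l = 0 ↔ ∀ p ∈ l, c p.1 = p.2 := by
  simp [mistakes, List.countP_eq_zero]

theorem IsERM.consistent {erm : List (X × Bool) → X → Bool} (herm : IsERM C erm) (hf : f ∈ C)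
    (x : Fin n → X) (i : Fin n) : erm (List.ofFn fun i => (x i, f (x i))) (x i) = f (x i) := by
  set data := List.ofFn fun i => (x i, f (x i))
  have hf0 : mistakes f data = 0 :=
    mistakes_eq_zero_iff.2 (List.forall_mem_ofFn_iff.2 fun _ => rfl)
  have herm0 : mistakes (erm data) data = 0 := Nat.le_zero.1 (hf0 ▸ (herm data).2 f hf)
  exact List.forall_mem_ofFn_iff.1 (mistakes_eq_zero_iff.1 herm0) i

theorem one_div_mul_card_filter_le_one (p : Fin n → Prop) [DecidablePred p] :
    1 / (n : ℝ) * (Finset.univ.filter p).card ≤ 1 := by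
  rw [one_div_mul_eq_div]
  refine div_le_one_of_le₀ ?_ n.cast_nonneg
  exact_mod_cast (Finset.card_filter_le _ _).trans_eq (Finset.card_fin n)

theorem empErr_nonneg (z : Fin n → X) (h : X → Bool) (S : Set X) (g : X → Bool) :
    0 ≤ empErr z h S g := by
  unfold empErr; positivity

theorem empErr_le_one (z : Fin n → X) (h : X → Bool) (S : Set X) (g : X → Bool) :
    empErr z h S g ≤ 1 := by
  classical exact one_div_mul_card_filter_le_one _

theorem empErr_eq_zero {g : X → Bool} {S : Set X} (hx : ∀ i, g (x i) = h (x i)) :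
    empErr x h S g = 0 := by
  simp [empErr, hx]

theorem one_div_le_empErr {g : X → Bool} {S : Set X} {i : Fin n} (hi : g (x i) ≠ h (x i))
    (hS : x i ∈ S) : 1 / (n : ℝ) ≤ empErr x h S g :=
  le_mul_of_one_le_right (by positivity) <|
    Nat.one_le_cast.2 (Finset.card_pos.2 ⟨i, by simp [hi, hS]⟩)

theorem choices_subset (hpick : IsMaximizing C Λ pick) (x x' : Fin n → X) (h : X → Bool) (t : ℕ) :
    ∀ c ∈ choices pick x x' h t, c ∈ C := by
  induction t with
  | zero => simp [choices]
  | succ t ih =>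
    rw [choices, List.forall_mem_append, List.forall_mem_singleton]
    exact ⟨ih, (hpick _ _ _ _).1⟩

theorem length_choices (pick : Rule X n) (x x' : Fin n → X) (h : X → Bool) (t : ℕ) :
    (choices pick x x' h t).length = t := by
  induction t with
  | zero => rfl
  | succ t ih => simp [choices, ih]

theorem agreeSet_append_singleton (h : X → Bool) (cs : List (X → Bool)) (c : X → Bool) :
    agreeSet h (cs ++ [c]) = agreeSet h cs ∩ {u | c u = h u} := by
  ext u
  simp [agreeSet, or_imp, forall_and]

theorem score_nonpos_of_train_ne (hΛ : n ≤ Λ) {c : X → Bool} {i : Fin n} (hi : c (x i) ≠ h (x i))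
    (S : Set X) : score Λ x x' h S c ≤ 0 := by
  have hn : (0 : ℝ) < n := Nat.cast_pos.2 i.pos
  have hpenalty : 1 ≤ Λ * empErr x h Set.univ c :=
    calc (1 : ℝ) = n * (1 / n) := (mul_one_div_cancel hn.ne').symm
      _ ≤ Λ * empErr x h Set.univ c := by
        have := one_div_le_empErr hi (Set.mem_univ _)
        gcongr
        exact hn.le.trans hΛ
  exact sub_nonpos.2 ((empErr_le_one _ _ _ _).trans hpenalty)

theorem train_mem_agreeSet (hΛ : n ≤ Λ) (hε : 0 ≤ ε) {t : ℕ}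
    (ht : ∀ s < t, ¬ Stops pick Λ ε x x' h s) (i : Fin n) :
    x i ∈ agreeSet h (choices pick x x' h t) := by
  induction t with
  | zero => simp [choices, agreeSet]
  | succ t ih =>
    rw [choices, agreeSet_append_singleton]
    refine ⟨ih fun s hs => ht s (hs.trans t.lt_succ_self), ?_⟩
    by_contra hne
    exact ht t t.lt_succ_self ((score_nonpos_of_train_ne hΛ hne _).trans hε)

open Classical in
/-- The fraction of the test points that have been rejected. -/
noncomputable def rejectedFraction (z : Fin n → X) (S : Set X) : ℝ :=
  1 / (n : ℝ) * (Finset.univ.filter fun i => z i ∉ S).card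

theorem rejectedFraction_le_one (z : Fin n → X) (S : Set X) : rejectedFraction z S ≤ 1 := by
  classical exact one_div_mul_card_filter_le_one _

theorem rejectedFraction_inter (z : Fin n → X) (S : Set X) (h c : X → Bool) :
    rejectedFraction z (S ∩ {u | c u = h u}) = rejectedFraction z S + empErr z h S c := by
  classical
  unfold rejectedFraction empErr
  rw [← mul_add, ← Nat.cast_add, ← Finset.card_union_of_disjoint]
  · congr 3
    ext i
    simp only [Finset.mem_filter, Finset.mem_univ, true_and, Finset.mem_union, Set.mem_inter_iff,
      Set.mem_ofPred_eq]
    tauto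
  · rw [Finset.disjoint_filter]
    tauto

theorem mul_le_rejectedFraction (hΛ : 0 ≤ Λ) {t : ℕ}
    (ht : ∀ s < t, ¬ Stops pick Λ ε x x' h s) :
    t * ε ≤ rejectedFraction x' (agreeSet h (choices pick x x' h t)) := by
  induction t with
  | zero => simp [rejectedFraction, choices, agreeSet]
  | succ t ih =>
    have hscore := ht t t.lt_succ_self
    rw [choices, agreeSet_append_singleton, rejectedFraction_inter, Nat.cast_succ, add_one_mul]
    unfold Stops score at hscore
    refine add_le_add (ih fun s hs => ht s (hs.trans t.lt_succ_self)) ?_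
    linarith [mul_nonneg hΛ (empErr_nonneg x h Set.univ (pick x x' h (choices pick x x' h t)))]

theorem le_floor_of_not_stops (hΛ : 0 ≤ Λ) (hε : 0 < ε) {t : ℕ}
    (ht : ∀ s < t, ¬ Stops pick Λ ε x x' h s) : t ≤ ⌊1 / ε⌋₊ :=
  Nat.le_floor <| (le_div_iff₀ hε).2 <|
    (mul_le_rejectedFraction hΛ ht).trans (rejectedFraction_le_one _ _)

theorem exists_stops (hΛ : 0 ≤ Λ) (hε : 0 < ε) (pick : Rule X n) (x x' : Fin n → X)
    (h : X → Bool) : ∃ t, Stops pick Λ ε x x' h t := by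
  by_contra! hcon
  exact (le_floor_of_not_stops hΛ hε fun s _ => hcon s).not_gt (Nat.lt_succ_self _)

theorem empErr_le_of_stops (hpick : IsMaximizing C Λ pick) (hf : f ∈ C)
    (hh : ∀ i, f (x i) = h (x i)) {t : ℕ} (ht : Stops pick Λ ε x x' h t) :
    empErr x' h (agreeSet h (choices pick x x' h t)) f ≤ ε := by
  have hscore := ((hpick x x' h (choices pick x x' h t)).2 f hf).trans ht
  rwa [score, empErr_eq_zero hh, mul_zero, sub_zero] at hscore

theorem rejectron_spec {erm : List (X × Bool) → X → Bool} (herm : IsERM C erm) (hΛ : n ≤ Λ)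
    (hpick : IsMaximizing C Λ pick) (hf : f ∈ C) (hε : 0 < ε) (x x' : Fin n → X) {h : X → Bool}
    (hh : h = erm (List.ofFn fun i => (x i, f (x i)))) :
    ∃ cs : List (X → Bool),
      (h, agreeSet h cs) ∈ rejectron erm pick Λ x (fun i => f (x i)) x' ε ∧
      (∀ c ∈ cs, c ∈ C) ∧ cs.length ≤ ⌊1 / ε⌋₊ ∧ (∀ i, x i ∈ agreeSet h cs) ∧
      empErr x' h (agreeSet h cs) f ≤ ε := by
  classical
  subst hh
  have hΛ0 : 0 ≤ Λ := n.cast_nonneg.trans hΛ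
  have H := exists_stops hΛ0 hε pick x x' (erm (List.ofFn fun i => (x i, f (x i))))
  have hmin := fun s (hs : s < Nat.find H) => Nat.find_min H hs
  refine ⟨choices pick x x' _ (Nat.find H), ⟨H, ?_⟩, choices_subset hpick _ _ _ _, ?_,
    train_mem_agreeSet hΛ hε.le hmin,
    empErr_le_of_stops hpick hf (fun i => (herm.consistent hf x i).symm) (Nat.find_spec H)⟩
  · simp only [rejectron]
  · rw [length_choices]
    exact le_floor_of_not_stops hΛ0 hε hmin

end Rejectron

section Arithmetic

variable {d n K : ℕ} {δ ε : ℝ}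

theorem div_add_le_mul_of_sqrt_add_le {a b m : ℝ} (ha : 0 ≤ a) (hb : 0 ≤ b) (hm : 0 < m)
    (hε : 0 < ε) (h : √(a / m) + b / m ≤ ε) : a / ε + b ≤ m * ε := by
  have hsqrt : √(a / m) ≤ ε := (le_add_of_nonneg_right (by positivity)).trans h
  have hdiv : a / m / ε ≤ √(a / m) := by
    rw [div_le_iff₀ hε]
    calc a / m = √(a / m) * √(a / m) := (Real.mul_self_sqrt (by positivity)).symm
      _ ≤ √(a / m) * ε := by gcongr
  calc a / ε + b = m * (a / m / ε + b / m) := by field_simp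
    _ ≤ m * ε := by gcongr; exact (by gcongr : _ ≤ √(a / m) + b / m).trans h

theorem exp_div_six_le_rpow {y : ℝ} (hy : 0 ≤ y) : Real.exp (y / 6) ≤ (32 / 27) ^ y := by
  have hbase : Real.exp (1 / 6) ≤ 32 / 27 := by
    refine le_of_pow_le_pow_left₀ (n := 6) (by norm_num) (by norm_num) ?_
    rw [← Real.exp_nat_mul]
    norm_num
    linarith [Real.exp_one_lt_d9]
  calc Real.exp (y / 6) = Real.exp (1 / 6) ^ y := by rw [← Real.exp_mul]; ring_nf
    _ ≤ (32 / 27) ^ y := by gcongr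

theorem three_mul_log_add_one_le {m : ℝ} (hm : 4 ≤ m) :
    3 * Real.log (m + 1) ≤ 4 * Real.log m := by
  have hpow : (m + 1) ^ 3 ≤ m ^ 4 :=
    calc (m + 1) ^ 3 ≤ (5 / 4 * m) ^ 3 := by gcongr; linarith
      _ = 125 / 64 * m ^ 3 := by ring
      _ ≤ m * m ^ 3 := by gcongr; linarith
      _ = m ^ 4 := by ring
  simpa only [Real.log_pow, Nat.cast_ofNat] using Real.log_le_log (by positivity) hpow

theorem one_sub_log_le_log_eight_div (hδ : 0 < δ) : 1 - Real.log δ ≤ Real.log (8 / δ) := by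
  have hlog8 : 1 ≤ Real.log 8 := by
    rw [Real.le_log_iff_exp_le (by norm_num)]
    linarith [Real.exp_one_lt_d9]
  rw [Real.log_div (by norm_num) hδ.ne']
  linarith

theorem growth_bound_pow_le_error_weight (hn : 1 ≤ n) (hδ : 0 < δ) (hδ1 : δ ≤ 1) (hε : 0 < ε)
    (hε2 : ε < 1 / 2) (hK : K ≤ 1 / ε)
    (h : √(8 * d * Real.log (2 * n) / n) + 8 * Real.log (8 / δ) / n ≤ ε) :
    (((2 * n + 1) ^ d) ^ K : ℕ) ≤ δ * (32 / 27 : ℝ) ^ (n * ε) := by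
  have hn1 : (1 : ℝ) ≤ n := Nat.one_le_cast.2 hn
  have hL : 0 ≤ Real.log (2 * n) := Real.log_nonneg (by linarith)
  have hl : 1 - Real.log δ ≤ Real.log (8 / δ) := one_sub_log_le_log_eight_div hδ
  have hlogδ : Real.log δ ≤ 0 := Real.log_nonpos hδ.le hδ1
  set A := d * Real.log (2 * n) / ε with hA
  have hA0 : 0 ≤ A := by positivity
  have hquad : 8 * A + 8 * Real.log (8 / δ) ≤ n * ε := by
    have := div_add_le_mul_of_sqrt_add_le (by positivity) (by linarith) (by linarith) hε h
    linarith [show 8 * d * Real.log (2 * n) / ε = 8 * A by rw [hA]; ring]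
  have hn2 : 4 ≤ 2 * (n : ℝ) := by nlinarith
  calc ((((2 * n + 1) ^ d) ^ K : ℕ) : ℝ) = Real.exp (d * K * Real.log (2 * n + 1)) := by
        rw [← Nat.cast_mul, Real.exp_nat_mul, Real.exp_log (by positivity), pow_mul]
        push_cast
        rfl
    _ ≤ Real.exp (d * (1 / ε) * (4 / 3 * Real.log (2 * n))) := by
        gcongr
        · exact Real.log_nonneg (by linarith)
        · linarith [three_mul_log_add_one_le hn2]
    _ = Real.exp (4 / 3 * A) := by rw [hA]; ring_nf
    _ ≤ Real.exp (Real.log δ + n * ε / 6) := by gcongr; linarith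
    _ = δ * Real.exp (n * ε / 6) := by rw [Real.exp_add, Real.exp_log hδ]
    _ ≤ δ * (32 / 27) ^ (n * ε) := by gcongr; exact exp_div_six_le_rpow (by positivity)

/-- The bound on the rejection rate for confidence `1 - δ`. -/
noncomputable def rejectionBound (d n : ℕ) (ε δ : ℝ) : ℝ :=
  2 / n * (2 * d / ε * Real.logb 2 (2 * n) + Real.logb 2 (2 / δ))

theorem rejectionBound_nonneg (hn : 1 ≤ n) (hδ : 0 < δ) (hδ1 : δ ≤ 1) (hε : 0 < ε) :
    0 ≤ rejectionBound d n ε δ := by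
  have hn1 : (1 : ℝ) ≤ n := Nat.one_le_cast.2 hn
  have hL : 0 ≤ Real.logb 2 (2 * n) := Real.logb_nonneg one_lt_two (by linarith)
  have hl : 0 ≤ Real.logb 2 (2 / δ) :=
    Real.logb_nonneg one_lt_two ((one_le_div hδ).2 (by linarith))
  unfold rejectionBound
  positivity

theorem two_rpow_mul_rejectionBound (hn : 1 ≤ n) (hδ : 0 < δ) :
    (2 : ℝ) ^ (n * rejectionBound d n ε δ) = (2 * n) ^ (4 * d / ε) * (2 / δ) ^ 2 := by
  have hn0 : (0 : ℝ) < n := Nat.cast_pos.2 hn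
  have hexp : n * rejectionBound d n ε δ =
      Real.logb 2 (2 * n) * (4 * d / ε) + Real.logb 2 (2 / δ) * (2 : ℕ) := by
    rw [rejectionBound, ← mul_assoc, mul_div_cancel₀ _ hn0.ne']
    push_cast
    ring
  rw [hexp, Real.rpow_add two_pos, Real.rpow_mul two_pos.le, Real.rpow_mul_natCast two_pos.le,
    Real.rpow_logb two_pos (by norm_num) (by positivity),
    Real.rpow_logb two_pos (by norm_num) (by positivity)]

theorem growth_bound_pow_le_rejection_weight (hn : 1 ≤ n) (hδ : 0 < δ) (hδ1 : δ ≤ 1)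
    (hε : 0 < ε) (hε1 : ε ≤ 1) (hK : K ≤ 1 / ε) :
    (((2 * n + 1) ^ d) ^ (K + 1) : ℕ) ≤ δ * (2 : ℝ) ^ (n * rejectionBound d n ε δ) := by
  have hn1 : (1 : ℝ) ≤ n := Nat.one_le_cast.2 hn
  have hK1 : (K : ℝ) + 1 ≤ 2 / ε := by
    have hε' : 1 ≤ 1 / ε := (one_le_div hε).2 hε1
    calc (K : ℝ) + 1 ≤ 1 / ε + 1 / ε := add_le_add hK hε'
      _ = 2 / ε := by ring
  have hδ4 : 1 ≤ δ * (2 / δ) ^ 2 :=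
    calc 1 ≤ 4 / δ := (one_le_div hδ).2 (by linarith)
      _ = δ * (2 / δ) ^ 2 := by field_simp; norm_num
  calc ((((2 * n + 1) ^ d) ^ (K + 1) : ℕ) : ℝ)
      = ((2 * n + 1 : ℝ) ^ d) ^ (K + 1) := by push_cast; rfl
    _ ≤ (((2 * n : ℝ) ^ 2) ^ d) ^ (K + 1) := by gcongr; nlinarith
    _ = (2 * n : ℝ) ^ (2 * d * (K + 1) : ℝ) := by
        rw [← pow_mul, ← pow_mul, ← Real.rpow_natCast]
        push_cast
        ring_nf
    _ ≤ (2 * n : ℝ) ^ (4 * d / ε) := by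
        refine Real.rpow_le_rpow_of_exponent_le (by linarith) ?_
        calc 2 * (d : ℝ) * (K + 1) ≤ 2 * d * (2 / ε) := by gcongr
          _ = 4 * d / ε := by ring
    _ ≤ (2 * n : ℝ) ^ (4 * d / ε) * (δ * (2 / δ) ^ 2) :=
        le_mul_of_one_le_right (by positivity) hδ4
    _ = δ * 2 ^ (n * rejectionBound d n ε δ) := by
        rw [two_rpow_mul_rejectionBound hn hδ, mul_left_comm]

theorem epsStar_eq (d n : ℕ) (δ : ℝ) :
    epsStar d n δ = √(8 * d * Real.log (2 * n) / n) + 8 * Real.log (8 / (δ / 2)) / n := by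
  rw [epsStar, show 8 / (δ / 2) = 16 / δ by rw [div_div_eq_mul_div]; norm_num]

theorem epsStar_pos (d : ℕ) (hn : 1 ≤ n) (hδ : 0 < δ) (hδ1 : δ ≤ 1) : 0 < epsStar d n δ := by
  have hl : 0 < Real.log (16 / δ) := Real.log_pos ((one_lt_div hδ).2 (by linarith))
  have : (0 : ℝ) < n := Nat.cast_pos.2 hn
  unfold epsStar
  positivity

theorem logb_two_le_two_mul_log {y : ℝ} (hy : 1 ≤ y) : Real.logb 2 y ≤ 2 * Real.log y := by
  rw [Real.logb, div_le_iff₀ (Real.log_pos one_lt_two)]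
  nlinarith [Real.log_two_gt_d9, Real.log_nonneg hy]

theorem rejectionBound_epsStar_le (d : ℕ) (hn : 1 ≤ n) (hδ : 0 < δ) (hδ1 : δ ≤ 1) :
    rejectionBound d n (epsStar d n δ) (δ / 2) ≤ epsStar d n δ := by
  have hn1 : (1 : ℝ) ≤ n := Nat.one_le_cast.2 hn
  have hε : 0 < epsStar d n δ := epsStar_pos d hn hδ hδ1
  have hL : 0 ≤ Real.log (2 * n) := Real.log_nonneg (by linarith)
  have hδ4 : 1 ≤ 2 / (δ / 2) := (one_le_div (by positivity)).2 (by linarith)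
  have hl : Real.log (2 / (δ / 2)) ≤ Real.log (8 / (δ / 2)) := by gcongr; norm_num
  have hl0 : 0 ≤ Real.log (8 / (δ / 2)) := (Real.log_nonneg hδ4).trans hl
  have hquad := div_add_le_mul_of_sqrt_add_le (by positivity) (by positivity) (by linarith) hε
    (epsStar_eq d n δ).ge
  set ε := epsStar d n δ
  rw [rejectionBound, div_mul_eq_mul_div, div_le_iff₀ (by linarith), mul_comm ε]
  calc 2 * (2 * d / ε * Real.logb 2 (2 * n) + Real.logb 2 (2 / (δ / 2)))
      ≤ 2 * (2 * d / ε * (2 * Real.log (2 * n)) + 2 * Real.log (2 / (δ / 2))) := by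
        gcongr
        · exact logb_two_le_two_mul_log (by linarith)
        · exact logb_two_le_two_mul_log hδ4
    _ = 8 * d * Real.log (2 * n) / ε + 4 * Real.log (2 / (δ / 2)) := by ring
    _ ≤ 8 * d * Real.log (2 * n) / ε + 8 * Real.log (8 / (δ / 2)) := by linarith
    _ ≤ n * ε := hquad

end Arithmetic

section Probability

variable {Y Z : Type*} [MeasurableSpace Y] [MeasurableSpace Z] {a b : ℝ}

theorem one_sub_add_le_measureReal_inter {μ : Measure Y} [IsProbabilityMeasure μ] {s t : Set Y}
    (ht : MeasurableSet t) (hs : 1 - a ≤ μ.real s) (h : 1 - b ≤ μ.real t) :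
    1 - (a + b) ≤ μ.real (s ∩ t) := by
  linarith [measureReal_union_add_inter (μ := μ) (s := s) ht,
    measureReal_le_one (μ := μ) (s := s ∪ t)]

theorem le_measureReal_prod_of_forall_section {μ : Measure Y} {ν : Measure Z}
    [IsProbabilityMeasure μ] [IsProbabilityMeasure ν] {E : Set (Y × Z)} (hE : MeasurableSet E)
    (h : ∀ y, a ≤ ν.real (Prod.mk y ⁻¹' E)) : a ≤ (μ.prod ν).real E := by
  refine (ENNReal.ofReal_le_iff_le_toReal (measure_ne_top _ _)).1 ?_
  rw [Measure.prod_apply hE]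
  calc ENNReal.ofReal a = ∫⁻ _, ENNReal.ofReal a ∂μ := by simp
    _ ≤ ∫⁻ y, ν (Prod.mk y ⁻¹' E) ∂μ := lintegral_mono fun y =>
        (ENNReal.ofReal_le_iff_le_toReal (measure_ne_top _ _)).2 (h y)

theorem one_sub_add_le_measureReal_prod {μ : Measure Y} {ν : Measure Z}
    [IsProbabilityMeasure μ] [IsProbabilityMeasure ν] {A : Set Y} {E : Set (Y × Z)}
    (hE : MeasurableSet E) (hA : 1 - a ≤ μ.real A)
    (h : ∀ y, 1 - b ≤ ν.real (Prod.mk y ⁻¹' E)) :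
    1 - (a + b) ≤ (μ.prod ν).real {z | z.1 ∈ A ∧ z ∈ E} := by
  have hA' : 1 - a ≤ (μ.prod ν).real (Prod.fst ⁻¹' A) := by
    rwa [← Set.prod_univ, measureReal_prod_prod, probReal_univ, mul_one]
  exact one_sub_add_le_measureReal_inter hE hA' (le_measureReal_prod_of_forall_section hE h)

end Probability

section Guarantees

variable {n d : ℕ} {Λ δ ε : ℝ} {erm : List (X × Bool) → X → Bool} {pick : Rule X n}
  {f : X → Bool}

theorem growth_rejectionClass_le_of_vcDim_le (hd : vcDim C ≤ d) (K n : ℕ) :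
    growth (rejectionClass C K) (2 * Fintype.card (Fin n)) ≤
      (((2 * n + 1) ^ d) ^ (K + 1) : ℕ) := by
  rw [Fintype.card_fin, Nat.cast_pow _ (K + 1)]
  exact (growth_rejectionClass_le C K _).trans
    (pow_le_pow_left' (growth_le_of_vcDim_le hd _) _)

theorem growth_errorClass_le_of_vcDim_le (hd : vcDim C ≤ d) {h : X → Bool} (hh : h ∈ C)
    (f : X → Bool) (K n : ℕ) :
    growth (errorClass C h f K) (2 * Fintype.card (Fin n)) ≤ (((2 * n + 1) ^ d) ^ K : ℕ) := by
  rw [Fintype.card_fin, Nat.cast_pow _ K]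
  exact (growth_errorClass_le hh f K _).trans (pow_le_pow_left' (growth_le_of_vcDim_le hd _) _)

open Classical in
theorem hits_le_mul_of_empErr_le (hn : 1 ≤ n) {z : Fin n → X} {h : X → Bool} {S : Set X}
    (hε : empErr z h S f ≤ ε) : hits (fun u => decide (h u ≠ f u ∧ u ∈ S)) z ≤ n * ε := by
  rw [empErr, one_div_mul_eq_div, div_le_iff₀' (Nat.cast_pos.2 hn)] at hε
  simpa only [hits, decide_eq_true_eq, ne_comm] using hε

variable [MeasurableSpace X]

theorem exists_rejectron_err_le (herm : IsERM C erm) (hn : 1 ≤ n) (hΛ : n ≤ Λ)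
    (hpick : IsMaximizing C Λ pick) (hf : f ∈ C) (hε : 0 < ε) {Q : Measure X} {x x' : Fin n → X}
    (hx' : ∀ G ∈ errorClass C (erm (List.ofFn fun i => (x i, f (x i)))) f ⌊1 / ε⌋₊,
      hits G x' ≤ n * ε → Q.real {u | G u = true} ≤ 2 * ε) :
    ∃ h S, (h, S) ∈ rejectron erm pick Λ x (fun i => f (x i)) x' ε ∧ err Q f h S ≤ 2 * ε := by
  obtain ⟨cs, hmem, hcs, hlen, -, herr⟩ := rejectron_spec herm hΛ hpick hf hε x x' rfl
  refine ⟨_, _, hmem, ?_⟩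
  simpa only [err, decide_eq_true_eq] using
    hx' _ ⟨cs, hcs, hlen, rfl⟩ (hits_le_mul_of_empErr_le hn herr)

theorem exists_rejectron_rej_le (herm : IsERM C erm) (hΛ : n ≤ Λ)
    (hpick : IsMaximizing C Λ pick) (hf : f ∈ C) (hε : 0 < ε) {P : Measure X} {γ : ℝ}
    {x : Fin n → X} (hx : ∀ G ∈ rejectionClass C ⌊1 / ε⌋₊, (∀ i, G (x i) = false) →
      P.real {u | G u = true} ≤ γ) (x' : Fin n → X) :
    ∃ h S, (h, S) ∈ rejectron erm pick Λ x (fun i => f (x i)) x' ε ∧ rej P S ≤ γ := by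
  obtain ⟨cs, hmem, hcs, hlen, htrain, -⟩ := rejectron_spec herm hΛ hpick hf hε x x' rfl
  refine ⟨_, _, hmem, ?_⟩
  simpa only [rej, decide_eq_true_eq] using
    hx _ ⟨_, (herm _).1, cs, hcs, hlen, rfl⟩ fun i => by simp [htrain i]

theorem exists_rejectron_rej_le_of_one_lt (herm : IsERM C erm) (hΛ : n ≤ Λ)
    (hpick : IsMaximizing C Λ pick) (hf : f ∈ C) (hε : 1 < ε) {P : Measure X} {γ : ℝ}
    (hγ : 0 ≤ γ) (x x' : Fin n → X) :
    ∃ h S, (h, S) ∈ rejectron erm pick Λ x (fun i => f (x i)) x' ε ∧ rej P S ≤ γ := by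
  have hε0 : 0 < ε := one_pos.trans hε
  obtain ⟨cs, hmem, -, hlen, -⟩ := rejectron_spec herm hΛ hpick hf hε0 x x' rfl
  rw [Nat.floor_eq_zero.2 ((div_lt_one hε0).2 hε), Nat.le_zero, List.length_eq_zero_iff] at hlen
  subst hlen
  exact ⟨_, _, hmem, by simpa [rej, agreeSet] using hγ⟩

variable [Countable X] [DiscreteMeasurableSpace X]

theorem error_guarantee (hd : vcDim C ≤ d) (hn : 1 ≤ n) (herm : IsERM C erm) (hΛ : n ≤ Λ)
    (hpick : IsMaximizing C Λ pick) (hf : f ∈ C) (Q : Measure X) [IsProbabilityMeasure Q]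
    (hδ : 0 < δ) (hε : √(8 * d * Real.log (2 * n) / n) + 8 * Real.log (8 / δ) / n ≤ ε)
    (x : Fin n → X) :
    1 - δ ≤ (Measure.pi fun _ : Fin n => Q).real {x' | ∃ h S,
      (h, S) ∈ rejectron erm pick Λ x (fun i => f (x i)) x' ε ∧ err Q f h S ≤ 2 * ε} := by
  rcases lt_or_ge 1 δ with hδ1 | hδ1
  · exact (sub_nonpos.2 hδ1.le).trans measureReal_nonneg
  have hl : 0 < Real.log (8 / δ) := Real.log_pos ((one_lt_div hδ).2 (by linarith))
  have : (0 : ℝ) < n := Nat.cast_pos.2 hn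
  have hε0 : 0 < ε := lt_of_lt_of_le (by positivity) hε
  rcases le_or_gt (1 / 2) ε with hε2 | hε2
  · refine (sub_le_self 1 hδ.le).trans ?_
    rw [← probReal_univ (μ := Measure.pi fun _ : Fin n => Q)]
    refine measureReal_mono fun x' _ => ?_
    exact exists_rejectron_err_le herm hn hΛ hpick hf hε0 fun G _ _ =>
      measureReal_le_one.trans (by linarith)
  have hK : (⌊1 / ε⌋₊ : ℝ) ≤ 1 / ε := Nat.floor_le (by positivity)
  have hgrowth := growth_errorClass_le_of_vcDim_le hd
    (herm (List.ofFn fun i => (x i, f (x i)))).1 f ⌊1 / ε⌋₊ n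
  have hcount := growth_bound_pow_le_error_weight hn hδ hδ1 hε0 hε2 hK hε
  have hdev := one_sub_le_measureReal_forall_hits_le hgrowth Q (δ := δ) (ε := ε)
  rw [Fintype.card_fin] at hdev
  exact (hdev hcount).trans <| measureReal_mono fun x' hx' =>
    exists_rejectron_err_le herm hn hΛ hpick hf hε0 hx'

theorem rejection_guarantee (hd : vcDim C ≤ d) (hn : 1 ≤ n) (herm : IsERM C erm) (hΛ : n ≤ Λ)
    (hpick : IsMaximizing C Λ pick) (hf : f ∈ C) (P : Measure X) [IsProbabilityMeasure P]
    (hδ : 0 < δ) (hε : 0 < ε) :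
    1 - δ ≤ (Measure.pi fun _ : Fin n => P).real {x | ∀ x', ∃ h S,
      (h, S) ∈ rejectron erm pick Λ x (fun i => f (x i)) x' ε ∧
        rej P S ≤ rejectionBound d n ε δ} := by
  rcases lt_or_ge 1 δ with hδ1 | hδ1
  · exact (sub_nonpos.2 hδ1.le).trans measureReal_nonneg
  rcases lt_or_ge 1 ε with hε1 | hε1
  · refine (sub_le_self 1 hδ.le).trans ?_
    rw [← probReal_univ (μ := Measure.pi fun _ : Fin n => P)]
    exact measureReal_mono fun x _ => exists_rejectron_rej_le_of_one_lt herm hΛ hpick hf hε1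
      (rejectionBound_nonneg hn hδ hδ1 hε) x
  have hK : (⌊1 / ε⌋₊ : ℝ) ≤ 1 / ε := Nat.floor_le (by positivity)
  have hgrowth := growth_rejectionClass_le_of_vcDim_le hd ⌊1 / ε⌋₊ n
  have hcount := growth_bound_pow_le_rejection_weight (d := d) hn hδ hδ1 hε hε1 hK
  have hnet := one_sub_le_measureReal_forall_consistent hgrowth P (δ := δ)
    (γ := rejectionBound d n ε δ)
  rw [Fintype.card_fin] at hnet
  exact (hnet hcount).trans <| measureReal_mono fun x hx =>
    exists_rejectron_rej_le herm hΛ hpick hf hε hx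

theorem balanced_guarantee (hd : vcDim C ≤ d) (hn : 1 ≤ n) (herm : IsERM C erm) (hΛ : n ≤ Λ)
    (hpick : IsMaximizing C Λ pick) (hf : f ∈ C) (P Q : Measure X) [IsProbabilityMeasure P]
    [IsProbabilityMeasure Q] (hδ : 0 < δ) :
    1 - δ ≤ ((Measure.pi fun _ : Fin n => P).prod (Measure.pi fun _ : Fin n => Q)).real
      {z | ∃ h S, (h, S) ∈ rejectron erm pick Λ z.1 (fun i => f (z.1 i)) z.2 (epsStar d n δ) ∧
        err Q f h S ≤ 2 * epsStar d n δ ∧ rej P S ≤ epsStar d n δ} := by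
  rcases lt_or_ge 1 δ with hδ1 | hδ1
  · exact (sub_nonpos.2 hδ1.le).trans measureReal_nonneg
  have hrej := rejection_guarantee hd hn herm hΛ hpick hf P (half_pos hδ)
    (epsStar_pos d hn hδ hδ1)
  have herr := error_guarantee hd hn herm hΛ hpick hf Q (half_pos hδ) (epsStar_eq d n δ).ge
  have hboth := one_sub_add_le_measureReal_prod .of_discrete hrej herr (E := {z | ∃ h S,
    (h, S) ∈ rejectron erm pick Λ z.1 (fun i => f (z.1 i)) z.2 (epsStar d n δ) ∧
      err Q f h S ≤ 2 * epsStar d n δ})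
  rw [add_halves] at hboth
  refine hboth.trans (measureReal_mono ?_)
  rintro ⟨x, x'⟩ ⟨hx, h, S, hS, herrS⟩
  obtain ⟨h', S', hS', hrejS⟩ := hx x'
  obtain ⟨rfl, rfl⟩ := Prod.mk.inj (Part.mem_unique hS hS')
  exact ⟨h, S, hS, herrS, hrejS.trans (rejectionBound_epsStar_le d hn hδ hδ1)⟩

end Guarantees

end PQ

theorem theorem5p2_general {X : Type*} [Countable X] [MeasurableSpace X] [DiscreteMeasurableSpace X]
    (C : Set (X → Bool)) (d : ℕ) (hd : PQ.vcDim C ≤ d)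
    (n : ℕ) (hn : 1 ≤ n)
    (Λ : ℝ) (hΛ : n ≤ Λ)
    (erm : List (X × Bool) → X → Bool) (herm : PQ.IsERM C erm)
    (pick : PQ.Rule X n) (hpick : PQ.IsMaximizing C Λ pick)
    (f : X → Bool) (hf : f ∈ C)
    (P Q : Measure X) [IsProbabilityMeasure P] [IsProbabilityMeasure Q]
    (δ : ℝ) (hδ : 0 < δ) :
    (1 - δ ≤ ((Measure.pi fun _ : Fin n => P).prod (Measure.pi fun _ : Fin n => Q)).real
      {z : (Fin n → X) × (Fin n → X) |
        ∃ h S, (h, S) ∈ PQ.rejectron erm pick Λ z.1 (fun i => f (z.1 i)) z.2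
            (PQ.epsStar d n δ) ∧
          PQ.err Q f h S ≤ 2 * PQ.epsStar d n δ ∧ PQ.rej P S ≤ PQ.epsStar d n δ}) ∧
    (∀ ε : ℝ, √(8 * d * Real.log (2 * n) / n) + 8 * Real.log (8 / δ) / n ≤ ε →
      ∀ x : Fin n → X,
        1 - δ ≤ (Measure.pi fun _ : Fin n => Q).real
          {x' : Fin n → X |
            ∃ h S, (h, S) ∈ PQ.rejectron erm pick Λ x (fun i => f (x i)) x' ε ∧
              PQ.err Q f h S ≤ 2 * ε}) ∧
    (∀ ε : ℝ, 0 < ε →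
      1 - δ ≤ (Measure.pi fun _ : Fin n => P).real
        {x : Fin n → X | ∀ x' : Fin n → X,
          ∃ h S, (h, S) ∈ PQ.rejectron erm pick Λ x (fun i => f (x i)) x' ε ∧
            PQ.rej P S ≤
              2 / n * (2 * d / ε * Real.logb 2 (2 * n) + Real.logb 2 (2 / δ))}) :=
  ⟨PQ.balanced_guarantee hd hn herm hΛ hpick hf P Q hδ,
    fun _ hε x => PQ.error_guarantee hd hn herm hΛ hpick hf Q hδ hε x,
    fun _ hε => PQ.rejection_guarantee hd hn herm hΛ hpick hf P hδ hε⟩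

theorem theorem5p2 {X : Type*} [Countable X] [MeasurableSpace X] [DiscreteMeasurableSpace X]
    (C : Set (X → Bool)) (d : ℕ) (hd : PQ.vcDim C = (d : ℕ∞))
    (n : ℕ) (hn : 1 ≤ n)
    (erm : List (X × Bool) → X → Bool) (herm : PQ.IsERM C erm)
    (pick : PQ.Rule X n) (hpick : PQ.IsMaximizing C ((n : ℝ) + 1) pick)
    (f : X → Bool) (hf : f ∈ C)
    (P Q : Measure X) [IsProbabilityMeasure P] [IsProbabilityMeasure Q]
    (δ : ℝ) (hδ : 0 < δ) :
    -- the guarantee with the balanced error parameter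
    (1 - δ ≤ ((Measure.pi fun _ : Fin n => P).prod (Measure.pi fun _ : Fin n => Q)).real
      {z : (Fin n → X) × (Fin n → X) |
        ∃ h S, (h, S) ∈ PQ.rejectron erm pick ((n : ℝ) + 1) z.1 (fun i => f (z.1 i)) z.2
            (PQ.epsStar d n δ) ∧
          PQ.err Q f h S ≤ 2 * PQ.epsStar d n δ ∧ PQ.rej P S ≤ PQ.epsStar d n δ}) ∧
    -- the general trade-off: errors
    (∀ ε : ℝ, √(8 * d * Real.log (2 * n) / n) + 8 * Real.log (8 / δ) / n ≤ ε →
      ∀ x : Fin n → X,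
        1 - δ ≤ (Measure.pi fun _ : Fin n => Q).real
          {x' : Fin n → X |
            ∃ h S, (h, S) ∈ PQ.rejectron erm pick ((n : ℝ) + 1) x (fun i => f (x i)) x' ε ∧
              PQ.err Q f h S ≤ 2 * ε}) ∧
    -- the general trade-off: rejections
    (∀ ε : ℝ, 0 < ε →
      1 - δ ≤ (Measure.pi fun _ : Fin n => P).real
        {x : Fin n → X | ∀ x' : Fin n → X,
          ∃ h S, (h, S) ∈ PQ.rejectron erm pick ((n : ℝ) + 1) x (fun i => f (x i)) x' ε ∧
            PQ.rej P S ≤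
              2 / n * (2 * d / ε * Real.logb 2 (2 * n) + Real.logb 2 (2 / δ))}) :=
  theorem5p2_general C d hd.le n hn _ (by linarith) erm herm pick hpick f hf P Q δ hδ
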